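/- For a finite simple graph $G$, let $\lambda(G)$ denote the largest eigenvalue of the adjacency matrix of $G$. For integers $1\le k\le n$, let $H_{n,k}=K_{k-1}\vee(K_{n-k}\cup K_1)$, i.e. the $n$-vertex graph consisting of a clique on $n-1$ vertices together with one additional vertex adjacent to exactly $k-1$ vertices of the clique (here $\cup$ denotes disjoint union and $\vee$ denotes join, obtained from the disjoint union by adding all edges between the two graphs). A graph $G$ is $F$-free if it contains no (not necessarily induced) subgraph isomorphic to $F$. Then there is an absolute constant $n_0$ such that the following holds for every $n\ge n_0$. Let $F$ be any $n$-vertex graph with no isolated vertices, with minimum degree $\delta(F)=\delta$ and maximum degree $\Delta(F)\le\sqrt{n}/40$. If $G$ is an $n$-vertex $F$-free graph, then $$\lambda(G)\le\lambda(H_{n,\delta}),$$ with equality if and only if $G$ is isomorphic to $H_{n,\delta}$. -/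

import Mathlib

open Classical in
/-- The (adjacency) spectral radius `λ(G) = λ₁(G)` of a finite graph: the largest of the real
eigenvalues of its adjacency matrix. -/
noncomputable def adjSpectralRadius {V : Type*} [Fintype V] (G : SimpleGraph V) : ℝ :=
  sSup (spectrum ℝ (G.adjMatrix ℝ))

open Classical in
/-- For a graph with at least one vertex, `adjSpectralRadius G` really is the largest eigenvalue
of the adjacency matrix (the supremum is attained). -/
theorem isGreatest_adjSpectralRadius {V : Type*} [Fintype V] [Nonempty V] (G : SimpleGraph V) :
    IsGreatest (spectrum ℝ (G.adjMatrix ℝ)) (adjSpectralRadius G) := by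
  have hA : (G.adjMatrix ℝ).IsHermitian := by
    rw [Matrix.IsHermitian, Matrix.conjTranspose_eq_transpose_of_trivial]
    exact G.isSymm_adjMatrix
  have hne : (spectrum ℝ (G.adjMatrix ℝ)).Nonempty := by
    rw [hA.spectrum_real_eq_range_eigenvalues]
    exact Set.range_nonempty _
  have hfin : (spectrum ℝ (G.adjMatrix ℝ)).Finite := Matrix.finite_real_spectrum
  exact ⟨hne.csSup_mem hfin, fun x hx => le_csSup hfin.bddAbove hx⟩

/-- The join `G ∨ H`: the disjoint union of `G` and `H` together with all edges between them. -/
def graphJoin {V W : Type*} (G : SimpleGraph V) (H : SimpleGraph W) : SimpleGraph (V ⊕ W) where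
  Adj
    | Sum.inl u, Sum.inl v => G.Adj u v
    | Sum.inr u, Sum.inr v => H.Adj u v
    | Sum.inl _, Sum.inr _ => True
    | Sum.inr _, Sum.inl _ => True
  symm := ⟨by
    rintro (u | u) (v | v) h
    · exact G.adj_symm h
    · trivial
    · trivial
    · exact H.adj_symm h⟩
  loopless := ⟨by
    rintro (u | u) h
    · exact G.irrefl h
    · exact H.irrefl h⟩

/-- `H_{n,k} = K_{k-1} ∨ (K_{n-k} ∪ K_1)`, for `1 ≤ k ≤ n`: an `(n-1)`-clique together with an
additional vertex joined to exactly `k - 1` vertices of the clique. -/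
def extremalH (n k : ℕ) : SimpleGraph (Fin (k - 1) ⊕ (Fin (n - k) ⊕ Fin 1)) :=
  graphJoin (SimpleGraph.completeGraph (Fin (k - 1)))
    ((SimpleGraph.completeGraph (Fin (n - k))).sum (SimpleGraph.completeGraph (Fin 1)))

/-!
Write `B` for the complement of `G` and `δ`, `Δ` for the minimum and maximum degree of `F`, and
suppose `λ(G) ≥ λ(H_{n,δ})`, so `λ(G) ≥ n - 2`. If some vertex of `G` has degree less than `δ`, then
`G` is a spanning subgraph of a copy of `H_{n,δ}` (`exists_le_starClique`), and the claim follows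
from monotonicity of the spectral radius and its strict form `eq_of_le_of_adjSpectralRadius_eq`.
Otherwise `G` has minimum degree at least `δ`, and it contains `F`
(`isContained_of_starClique_le`).

The spectral input is a Perron vector `x` of `G` with largest entry `1`. The eigenvalue equation at
that entry gives `∑ (1 - x u) ≤ 1`, so `x` is almost constant. It follows that `B` has fewer than
`n` edges (`sum_degree_compl_lt`). It also follows, by comparing the Rayleigh quotients of `x` for
`G` and for a copy of `H_{n,δ}`, that if a vertex `v` has at most `n / 10` neighbours in `G`, then
at least `δ` of these are adjacent to every other vertex of `G`
(`card_filter_degree_compl_ne_zero_lt`).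

It remains to find a bijection that maps no edge of `F` to an edge of `B`. The vertices of
`B`-degree more than `n / (40 Δ)`, of which there are at most `80 Δ`, receive their preimages
greedily (`IsSafe.exists_union`), in such a way that no other vertex of `F` is adjacent to preimages of total
`B`-degree more than `9 n / 10`. The vertex `v` of largest `B`-degree is the only one for which this
may be impossible; if it is, `v` receives a vertex of `F` of degree `δ`, whose neighbours are mapped
to `δ` vertices adjacent to all others. Among the bijections extending this assignment, one with
the fewest edges of `F` mapped to edges of `B` has none, since otherwise a single exchange of two
values would decrease their number (`exists_packing_of_partial`), as in the proof of the
Sauer–Spencer theorem.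
-/

namespace SpectralSpanning

open Finset Matrix

/-! ### Packing by exchanges -/

section Packing

variable {α β : Type*} [Fintype α] [Fintype β] [DecidableEq α] [DecidableEq β]

/-- The ordered pairs that are adjacent in `F` and whose images under `π` are adjacent in `B`. -/
def badPairs (F : SimpleGraph α) [DecidableRel F.Adj] (B : SimpleGraph β) [DecidableRel B.Adj]
    (π : α ≃ β) : Finset (α × α) :=
  univ.filter fun p => F.Adj p.1 p.2 ∧ B.Adj (π p.1) (π p.2)

variable (F : SimpleGraph α) [DecidableRel F.Adj] (B : SimpleGraph β) [DecidableRel B.Adj]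

variable {F B} in
omit [Fintype β] [DecidableEq α] [DecidableEq β] in
theorem mem_badPairs {π : α ≃ β} {a b : α} :
    (a, b) ∈ badPairs F B π ↔ F.Adj a b ∧ B.Adj (π a) (π b) := by
  simp [badPairs]

omit [Fintype β] [DecidableEq β] in
theorem badPairs_swap_ssubset (π : α ≃ β) {x y z : α} (hzx : z ≠ x) (hzy : z ≠ y)
    (hxy : F.Adj x y) (hbad : B.Adj (π x) (π y))
    (h₁ : ∀ y', F.Adj y y' → ¬ B.Adj (π y') (π z))
    (h₂ : ∀ z', F.Adj z z' → ¬ B.Adj (π z') (π y)) :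
    badPairs F B ((Equiv.swap y z).trans π) ⊂ badPairs F B π := by
  have hx : Equiv.swap y z x = x := Equiv.swap_apply_of_ne_of_ne hxy.ne hzx.symm
  refine Finset.ssubset_iff_subset_ne.2 ⟨?_, ?_⟩
  · rintro ⟨a, b⟩ hab
    rw [mem_badPairs, Equiv.trans_apply, Equiv.trans_apply] at hab
    rw [mem_badPairs]
    obtain ⟨hF, hB⟩ := hab
    refine ⟨hF, ?_⟩
    by_cases hay : a = y
    · subst hay
      rw [Equiv.swap_apply_left] at hB
      by_cases hbz : b = z
      · subst hbz
        rw [Equiv.swap_apply_right] at hB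
        exact hB.symm
      · rw [Equiv.swap_apply_of_ne_of_ne hF.ne' hbz] at hB
        exact absurd hB.symm (h₁ b hF)
    by_cases haz : a = z
    · subst haz
      rw [Equiv.swap_apply_right] at hB
      by_cases hby : b = y
      · subst hby
        rw [Equiv.swap_apply_left] at hB
        exact hB.symm
      · rw [Equiv.swap_apply_of_ne_of_ne hby hF.ne'] at hB
        exact absurd hB.symm (h₂ b hF)
    rw [Equiv.swap_apply_of_ne_of_ne hay haz] at hB
    by_cases hby : b = y
    · subst hby
      rw [Equiv.swap_apply_left] at hB
      exact absurd hB (h₁ a hF.symm)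
    by_cases hbz : b = z
    · subst hbz
      rw [Equiv.swap_apply_right] at hB
      exact absurd hB (h₂ a hF.symm)
    rwa [Equiv.swap_apply_of_ne_of_ne hby hbz] at hB
  · intro h
    have hmem : (x, y) ∈ badPairs F B π := mem_badPairs.2 ⟨hxy, hbad⟩
    rw [← h, mem_badPairs, Equiv.trans_apply, Equiv.trans_apply, hx,
      Equiv.swap_apply_left] at hmem
    exact h₁ x hxy.symm hmem.2

omit [DecidableEq β] in
/-- The counting step of the swapping argument: if the `B`-degrees around `y` are small, then some
`z` outside `P` can be exchanged with `y` without creating a bad pair. -/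
theorem exists_swap_partner {D : ℕ} (hD : ∀ v, F.degree v ≤ D) (π : α ≃ β) (P : Finset α)
    (x y : α) (hy : 40 * D * B.degree (π y) ≤ Fintype.card α)
    (hw : 40 * ∑ y' ∈ F.neighborFinset y, B.degree (π y') ≤ 37 * Fintype.card α)
    (hP : 20 * (P.card + 2) < Fintype.card α) :
    ∃ z, z ∉ P ∧ z ≠ x ∧ z ≠ y ∧ (∀ y', F.Adj y y' → ¬ B.Adj (π y') (π z)) ∧
      (∀ z', F.Adj z z' → ¬ B.Adj (π z') (π y)) := by
  classical
  set E₁ : Finset α := (F.neighborFinset y).biUnion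
    fun y' => (B.neighborFinset (π y')).map π.symm.toEmbedding with hE₁
  set E₂ : Finset α := (B.neighborFinset (π y)).biUnion
    fun w => F.neighborFinset (π.symm w) with hE₂
  have c₁ : E₁.card ≤ ∑ y' ∈ F.neighborFinset y, B.degree (π y') := by
    refine card_biUnion_le.trans (le_of_eq ?_)
    simp
  have c₂ : E₂.card ≤ B.degree (π y) * D := by
    refine card_biUnion_le.trans ?_
    refine (Finset.sum_le_card_nsmul _ _ D fun w _ => ?_).trans (by simp)
    simpa using hD _
  have c₃ : (P ∪ {x, y}).card ≤ P.card + 2 :=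
    (card_union_le _ _).trans (Nat.add_le_add_left card_le_two _)
  have hlt : (E₁ ∪ E₂ ∪ (P ∪ {x, y})).card < (univ : Finset α).card := by
    have h1 := card_union_le (E₁ ∪ E₂) (P ∪ {x, y})
    have h2 := card_union_le E₁ E₂
    have h3 : 40 * (B.degree (π y) * D) ≤ Fintype.card α := by
      rw [mul_comm (B.degree (π y)) D, ← mul_assoc]; exact hy
    rw [card_univ]
    omega
  obtain ⟨z, -, hz⟩ := exists_mem_notMem_of_card_lt_card hlt
  simp only [mem_union, not_or, mem_insert, mem_singleton] at hz
  obtain ⟨⟨hz₁, hz₂⟩, hzP, hzx, hzy⟩ := hz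
  refine ⟨z, hzP, hzx, hzy, fun y' hy' hB => hz₁ ?_, fun z' hz' hB => hz₂ ?_⟩
  · simp only [hE₁, mem_biUnion, mem_map, SimpleGraph.mem_neighborFinset]
    exact ⟨y', hy', π z, hB, by simp⟩
  · simp only [hE₂, mem_biUnion, SimpleGraph.mem_neighborFinset]
    exact ⟨π z', hB.symm, by simpa using hz'.symm⟩

/-- A variant of the Sauer–Spencer packing theorem. If a bijection `π₀` places no edge of `F`
inside the small set `P` onto an edge of `B`, puts only vertices of low `B`-degree outside `P`, and
no vertex outside `P` sees too much `B`-degree inside `P`, then `π₀` can be changed outside `P` so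
that no edge of `F` is mapped to an edge of `B`. -/
theorem exists_packing_of_partial {D : ℕ} (hD : ∀ v, F.degree v ≤ D) (hD₀ : 0 < D)
    (π₀ : α ≃ β) (P : Finset α)
    (hgood : ∀ x ∈ P, ∀ y ∈ P, F.Adj x y → ¬ B.Adj (π₀ x) (π₀ y))
    (hlow : ∀ y ∉ P, 40 * D * B.degree (π₀ y) ≤ Fintype.card α)
    (hw : ∀ y ∉ P, 10 * ∑ x ∈ P with F.Adj x y, B.degree (π₀ x) ≤ 9 * Fintype.card α)
    (hP : 20 * (P.card + 2) < Fintype.card α) :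
    ∃ π : α ≃ β, ∀ x y, F.Adj x y → ¬ B.Adj (π x) (π y) := by
  classical
  obtain ⟨π, hπ, hmin⟩ := Finset.exists_min_image
    (univ.filter fun π : α ≃ β => ∀ x ∈ P, π x = π₀ x) (fun π => (badPairs F B π).card)
    ⟨π₀, by simp⟩
  simp only [mem_filter, mem_univ, true_and] at hπ hmin
  have hlow' : ∀ y ∉ P, 40 * D * B.degree (π y) ≤ Fintype.card α := by
    intro y hy
    have : π₀.symm (π y) ∉ P := fun h => hy <| by
      have h2 := hπ _ h
      rw [Equiv.apply_symm_apply, EmbeddingLike.apply_eq_iff_eq] at h2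
      rwa [h2] at h
    have h3 := hlow _ this
    rwa [Equiv.apply_symm_apply] at h3
  have key : ∀ x y, y ∉ P → F.Adj x y → ¬ B.Adj (π x) (π y) := by
    intro x y hy hxy hbad
    have hsum : 40 * ∑ y' ∈ F.neighborFinset y, B.degree (π y') ≤ 37 * Fintype.card α := by
      -- Neighbours in `P` contribute `36 n` at most; the others have low degree and contribute `n`.
      rw [← sum_filter_add_sum_filter_not (F.neighborFinset y) (· ∈ P)]
      have e1 : ∑ y' ∈ F.neighborFinset y with y' ∈ P, B.degree (π y')
          = ∑ x ∈ P with F.Adj x y, B.degree (π₀ x) := by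
        refine Finset.sum_congr ?_ fun a ha => ?_
        · ext a; simp [and_comm, F.adj_comm]
        · rw [hπ a (mem_filter.1 ha).1]
      have e2 : 40 * ∑ y' ∈ F.neighborFinset y with y' ∉ P, B.degree (π y')
          ≤ Fintype.card α := by
        refine Nat.le_of_mul_le_mul_left ?_ hD₀
        calc D * (40 * ∑ y' ∈ F.neighborFinset y with y' ∉ P, B.degree (π y'))
            = ∑ y' ∈ F.neighborFinset y with y' ∉ P, 40 * D * B.degree (π y') := by
              rw [mul_sum, mul_sum]; refine sum_congr rfl fun _ _ => by ring
          _ ≤ ({y' ∈ F.neighborFinset y | y' ∉ P}).card • Fintype.card α :=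
              sum_le_card_nsmul _ _ _ fun a ha => hlow' a (mem_filter.1 ha).2
          _ ≤ D * Fintype.card α := by
              rw [smul_eq_mul]
              exact Nat.mul_le_mul_right _ ((card_filter_le _ _).trans (hD y))
      have := hw y hy
      rw [e1]
      omega
    obtain ⟨z, hzP, hzx, hzy, h₁, h₂⟩ :=
      exists_swap_partner F B hD π P x y (hlow' y hy) hsum hP
    refine absurd (hmin ((Equiv.swap y z).trans π) fun a ha => ?_) (not_le.2 <|
      card_lt_card (badPairs_swap_ssubset F B π hzx hzy hxy hbad h₁ h₂))
    rw [Equiv.trans_apply, Equiv.swap_apply_of_ne_of_ne, hπ a ha]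
    · rintro rfl; exact hy ha
    · rintro rfl; exact hzP ha
  refine ⟨π, fun x y hxy hbad => ?_⟩
  by_cases hy : y ∈ P
  · by_cases hx : x ∈ P
    · exact hgood x hx y hy hxy (by rwa [← hπ x hx, ← hπ y hy])
    · exact key y x hx hxy.symm hbad.symm
  · exact key x y hy hxy hbad

/-- An assignment `f` of vertices of `F` to the vertices in `T`, to be extended to a bijection whose
inverse maps no edge of `F` to an edge of `B`: it is injective, no edge of `F` comes from an edge of
`B`, and for every vertex of `F` outside the image of `T`, the vertices of `T` assigned to its
neighbours have total `B`-degree at most `9/10` of the number of vertices. -/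
structure IsSafe (T : Finset β) (f : β → α) : Prop where
  injOn : Set.InjOn f T
  good : ∀ s ∈ T, ∀ t ∈ T, F.Adj (f s) (f t) → ¬ B.Adj s t
  weight : ∀ y ∉ T.image f,
    10 * ∑ s ∈ T with F.Adj (f s) y, B.degree s ≤ 9 * Fintype.card α

variable {F B}

/-- A vertex of `B`-degree at most half the number of vertices can always be added to a safe
assignment. -/
theorem IsSafe.exists_insert {D : ℕ} (hD : ∀ v, F.degree v ≤ D) {T : Finset β} {f : β → α}
    (h : IsSafe F B T f) (hB : ∑ v, B.degree v ≤ 2 * Fintype.card α)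
    (hT : T.card * (D + 1) + 5 * D * D < Fintype.card α) {s : β} (hs : s ∉ T)
    (hds : 2 * B.degree s ≤ Fintype.card α) :
    ∃ g : β → α, (∀ t ∈ T, g t = f t) ∧ IsSafe F B (insert s T) g := by
  classical
  set n := Fintype.card α with hn
  let w : α → ℕ := fun y => ∑ t ∈ T with F.Adj (f t) y, B.degree t
  -- A neighbour of `B`-degree at most `n / 2` lifts the weight of any other vertex to at most
  -- `2 n / 5 + n / 2 = 9 n / 10`.
  let heavy : Finset α := univ.filter fun y => 2 * n < 5 * w y
  have hwsum : ∑ y, w y ≤ 2 * n * D := by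
    calc ∑ y, w y = ∑ t ∈ T, ∑ y, if F.Adj (f t) y then B.degree t else 0 := by
          simp only [w, sum_filter]
          exact sum_comm
      _ = ∑ t ∈ T, F.degree (f t) * B.degree t := by
          refine sum_congr rfl fun t _ => ?_
          rw [← sum_filter, sum_const, smul_eq_mul, ← F.card_neighborFinset_eq_degree (f t),
            SimpleGraph.neighborFinset_eq_filter]
      _ ≤ ∑ t ∈ T, D * B.degree t := sum_le_sum fun t _ => Nat.mul_le_mul_right _ (hD _)
      _ = D * ∑ t ∈ T, B.degree t := by rw [mul_sum]
      _ ≤ D * (2 * n) := Nat.mul_le_mul_left _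
          ((sum_le_sum_of_subset (subset_univ T)).trans hB)
      _ = 2 * n * D := by ring
  have hheavy : heavy.card ≤ 5 * D := by
    have h1 : heavy.card * (2 * n) ≤ ∑ y ∈ heavy, 5 * w y := by
      rw [← smul_eq_mul]
      exact card_nsmul_le_sum _ _ _ fun y hy => (mem_filter.1 hy).2.le
    have h2 : ∑ y ∈ heavy, 5 * w y ≤ 5 * (2 * n * D) := by
      rw [← mul_sum]
      exact Nat.mul_le_mul_left _ ((sum_le_sum_of_subset (subset_univ _)).trans hwsum)
    have hpos : 0 < 2 * n := by omega
    refine Nat.le_of_mul_le_mul_right ?_ hpos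
    calc heavy.card * (2 * n) ≤ 5 * (2 * n * D) := h1.trans h2
      _ = 5 * D * (2 * n) := by ring
  set E : Finset α := (T.biUnion fun t => insert (f t) (F.neighborFinset (f t))) ∪
    heavy.biUnion fun y => F.neighborFinset y with hE
  have hEcard : E.card < (univ : Finset α).card := by
    have h1 := card_union_le (T.biUnion fun t => insert (f t) (F.neighborFinset (f t)))
      (heavy.biUnion fun y => F.neighborFinset y)
    rw [← hE] at h1
    have h2 : (T.biUnion fun t => insert (f t) (F.neighborFinset (f t))).card ≤
        T.card * (D + 1) :=
      card_biUnion_le_card_mul _ _ _ fun t _ => (card_insert_le _ _).trans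
        (Nat.add_le_add_right (hD _) 1)
    have h3 : (heavy.biUnion fun y => F.neighborFinset y).card ≤ 5 * D * D :=
      (card_biUnion_le_card_mul _ _ D fun y _ => hD y).trans (Nat.mul_le_mul_right _ hheavy)
    rw [card_univ]
    omega
  obtain ⟨x, -, hx⟩ := exists_mem_notMem_of_card_lt_card hEcard
  simp only [hE, mem_union, mem_biUnion, mem_insert, SimpleGraph.mem_neighborFinset, not_or,
    not_exists, not_and] at hx
  obtain ⟨hxT, hxH⟩ := hx
  refine ⟨Function.update f s x, fun t ht => ?_, ?_⟩
  · exact Function.update_of_ne (by rintro rfl; exact hs ht) _ _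
  have hg : ∀ t ∈ T, Function.update f s x t = f t := fun t ht =>
    Function.update_of_ne (by rintro rfl; exact hs ht) _ _
  have hgs : Function.update f s x s = x := Function.update_self _ _ _
  generalize Function.update f s x = g at hg hgs
  refine ⟨?_, ?_, ?_⟩
  · rw [coe_insert, Set.injOn_insert (by simpa using hs)]
    refine ⟨?_, ?_⟩
    · rw [Set.EqOn.injOn_iff (f₂ := f) fun t ht => hg t ht]
      exact h.injOn
    · rintro ⟨t, ht, hts⟩
      rw [hgs, hg t ht] at hts
      exact (hxT t ht).1 hts.symm
  · intro a ha b hb hab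
    rw [mem_insert] at ha hb
    rcases ha with rfl | ha <;> rcases hb with rfl | hb
    · exact B.irrefl
    · rw [hgs, hg b hb] at hab
      exact absurd hab.symm (hxT b hb).2
    · rw [hgs, hg a ha] at hab
      exact absurd hab (hxT a ha).2
    · rw [hg a ha, hg b hb] at hab
      exact h.good a ha b hb hab
  · intro y hy
    have hyT : y ∉ T.image f := by
      simp only [mem_image, not_exists, not_and] at hy ⊢
      exact fun t ht => hg t ht ▸ hy t (mem_insert_of_mem ht)
    have hsum : ∑ t ∈ T with F.Adj (g t) y, B.degree t = w y := by
      refine sum_congr (filter_congr fun t ht => by rw [hg t ht]) fun _ _ => rfl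
    rw [filter_insert]
    split_ifs with hadj
    · rw [sum_insert (by simp [hs]), hsum]
      rw [hgs] at hadj
      have : ¬ 2 * n < 5 * w y := fun hlt =>
        hxH y (mem_filter.2 ⟨mem_univ _, hlt⟩) hadj.symm
      omega
    · rw [hsum]
      exact h.weight y hyT

theorem IsSafe.exists_union {D : ℕ} (hD : ∀ v, F.degree v ≤ D) {T : Finset β} {f : β → α}
    (h : IsSafe F B T f) (hB : ∑ v, B.degree v ≤ 2 * Fintype.card α) (S : Finset β)
    (hT : (T.card + S.card) * (D + 1) + 5 * D * D < Fintype.card α)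
    (hS : ∀ s ∈ S, s ∉ T → 2 * B.degree s ≤ Fintype.card α) :
    ∃ g : β → α, IsSafe F B (S ∪ T) g := by
  classical
  induction S using Finset.induction_on with
  | empty => exact ⟨f, by simpa using h⟩
  | insert s S hs ih =>
    rw [card_insert_of_notMem hs] at hT
    have hle : (T.card + S.card) * (D + 1) ≤ (T.card + (S.card + 1)) * (D + 1) :=
      Nat.mul_le_mul_right _ (by omega)
    obtain ⟨g, hg⟩ := ih (by omega) fun t ht => hS t (mem_insert_of_mem ht)
    rw [insert_union]
    by_cases hmem : s ∈ S ∪ T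
    · exact ⟨g, by rwa [insert_eq_of_mem hmem]⟩
    · have hcard : (S ∪ T).card * (D + 1) ≤ (T.card + S.card) * (D + 1) :=
        Nat.mul_le_mul_right _ ((card_union_le _ _).trans (by omega))
      obtain ⟨g', -, hg'⟩ := hg.exists_insert hD hB (by omega) hmem
        (hS s (mem_insert_self _ _) fun hsT => hmem (mem_union_right _ hsT))
      exact ⟨g', hg'⟩

/-- A safe assignment of at most `D + 1` vertices extends to an embedding of `F` that avoids `B`,
when all other vertices have `B`-degree at most half the number of vertices. The vertices whose
`B`-degree is too large for swapping are assigned first. -/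
theorem IsSafe.exists_packing {D : ℕ} (hD : ∀ v, F.degree v ≤ D) (hD₀ : 0 < D)
    (hcard : Fintype.card α = Fintype.card β) (hn₁ : 1600 * (D * D) ≤ Fintype.card α)
    (hn₂ : 40000 * D ≤ Fintype.card α) {T : Finset β} {f : β → α} (h : IsSafe F B T f)
    (hT : T.card ≤ D + 1) (hB : ∑ v, B.degree v ≤ 2 * Fintype.card α)
    (hdeg : ∀ s ∉ T, 2 * B.degree s ≤ Fintype.card α) :
    ∃ π : α ≃ β, ∀ x y, F.Adj x y → ¬ B.Adj (π x) (π y) := by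
  classical
  set n := Fintype.card α with hn
  let S : Finset β := univ.filter fun v => n < 40 * D * B.degree v
  have hpos : 0 < n := by omega
  have hS : S.card ≤ 80 * D := by
    refine Nat.le_of_mul_le_mul_right ?_ hpos
    calc S.card * n ≤ ∑ v ∈ S, 40 * D * B.degree v := by
          rw [← smul_eq_mul]
          exact card_nsmul_le_sum _ _ _ fun y hy => (mem_filter.1 hy).2.le
      _ ≤ ∑ v, 40 * D * B.degree v := sum_le_sum_of_subset (subset_univ _)
      _ = 40 * D * ∑ v, B.degree v := by rw [mul_sum]
      _ ≤ 40 * D * (2 * n) := Nat.mul_le_mul_left _ hB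
      _ = 80 * D * n := by ring
  obtain ⟨g, hg⟩ := h.exists_union hD hB S (by nlinarith) fun s _ hs => hdeg s hs
  obtain ⟨e, he⟩ := Finset.exists_equiv_extend_of_card_eq (s := S ∪ T) (t := univ) (f := g)
    (by rw [← hcard, card_univ]) (subset_univ _) hg.injOn
  let π₀ : α ≃ β := (e.trans (Equiv.subtypeUnivEquiv (fun x => mem_univ x))).symm
  have hπ : ∀ s ∈ S ∪ T, π₀ (g s) = s := by
    intro s hs
    rw [Equiv.symm_apply_eq]
    exact (he s hs).symm
  have hπ' : ∀ y, y ∉ (S ∪ T).image g → π₀ y ∉ S ∪ T := by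
    intro y hy hmem
    refine hy (mem_image.2 ⟨π₀ y, hmem, π₀.injective (hπ _ hmem)⟩)
  refine exists_packing_of_partial F B hD hD₀ π₀ ((S ∪ T).image g) ?_ ?_ ?_ ?_
  · simp only [mem_image]
    rintro _ ⟨s, hs, rfl⟩ _ ⟨t, ht, rfl⟩ hadj
    rw [hπ s hs, hπ t ht]
    exact hg.good s hs t ht hadj
  · intro y hy
    have := hπ' y hy
    simp only [mem_union, not_or, S, mem_filter, mem_univ, true_and, not_lt] at this
    exact this.1
  · intro y hy
    refine le_trans (le_of_eq ?_) (hg.weight y hy)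
    congr 1
    rw [filter_image, sum_image (fun a ha b hb => hg.injOn (mem_filter.1 ha).1 (mem_filter.1 hb).1)]
    exact sum_congr rfl fun s hs => by rw [hπ s (mem_filter.1 hs).1]
  · have h1 : ((S ∪ T).image g).card ≤ S.card + T.card :=
      card_image_le.trans (card_union_le _ _)
    omega

end Packing

/-! ### Perron vectors of almost complete graphs -/

theorem adjSpectralRadius_eq_of_iso {V W : Type*} [Fintype V] [Fintype W] {G : SimpleGraph V}
    {H : SimpleGraph W} (e : G ≃g H) : adjSpectralRadius G = adjSpectralRadius H := by
  classical
  unfold adjSpectralRadius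
  rw [← e.reindex_adjMatrix ℝ]
  exact congrArg sSup
    (AlgEquiv.spectrum_eq (reindexAlgEquiv ℝ ℝ e.toEquiv) (G.adjMatrix ℝ)).symm

section Spectral

variable {V : Type*} [Fintype V] [DecidableEq V]

theorem isGreatest_spectrum_adjMatrix [Nonempty V] (G : SimpleGraph V) [DecidableRel G.Adj] :
    IsGreatest (spectrum ℝ (G.adjMatrix ℝ)) (adjSpectralRadius G) := by
  convert isGreatest_adjSpectralRadius G

omit [DecidableEq V] in
theorem neighborFinset_subset_of_le {G H : SimpleGraph V} [DecidableRel G.Adj] [DecidableRel H.Adj]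
    (h : G ≤ H) (u : V) : G.neighborFinset u ⊆ H.neighborFinset u := fun w hw => by
  rw [SimpleGraph.mem_neighborFinset] at hw ⊢
  exact h hw

variable [Nonempty V] (G : SimpleGraph V) [DecidableRel G.Adj]

theorem posSemidef_algebraMap_sub_adjMatrix :
    (algebraMap ℝ (Matrix V V ℝ) (adjSpectralRadius G) - G.adjMatrix ℝ).PosSemidef := by
  rw [posSemidef_iff_isHermitian_and_spectrum_nonneg]
  refine ⟨?_, ?_⟩
  · rw [IsHermitian, conjTranspose_eq_transpose_of_trivial, transpose_sub,
      SimpleGraph.transpose_adjMatrix, algebraMap_eq_diagonal, diagonal_transpose]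
  · rw [← spectrum.singleton_sub_eq]
    rintro _ ⟨a, rfl, b, hb, rfl⟩
    exact sub_nonneg.2 ((isGreatest_spectrum_adjMatrix G).2 hb)

omit [Nonempty V] in
theorem dotProduct_algebraMap_sub_adjMatrix (x : V → ℝ) :
    star x ⬝ᵥ ((algebraMap ℝ (Matrix V V ℝ) (adjSpectralRadius G) - G.adjMatrix ℝ) *ᵥ x) =
      adjSpectralRadius G * ∑ u, x u ^ 2 - ∑ u, x u * ∑ w ∈ G.neighborFinset u, x w := by
  rw [sub_mulVec, dotProduct_sub, Algebra.algebraMap_eq_smul_one, smul_mulVec, one_mulVec,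
    dotProduct_smul]
  simp [dotProduct, SimpleGraph.adjMatrix_mulVec_apply, sq]

theorem rayleigh_le (x : V → ℝ) :
    ∑ u, x u * ∑ w ∈ G.neighborFinset u, x w ≤ adjSpectralRadius G * ∑ u, x u ^ 2 := by
  have h := (posSemidef_algebraMap_sub_adjMatrix G).dotProduct_mulVec_nonneg x
  rw [dotProduct_algebraMap_sub_adjMatrix] at h
  linarith

theorem eigen_of_rayleigh_ge {x : V → ℝ}
    (h : adjSpectralRadius G * ∑ u, x u ^ 2 ≤ ∑ u, x u * ∑ w ∈ G.neighborFinset u, x w) (u : V) :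
    ∑ w ∈ G.neighborFinset u, x w = adjSpectralRadius G * x u := by
  have h0 := (posSemidef_algebraMap_sub_adjMatrix G).dotProduct_mulVec_zero_iff x
  rw [dotProduct_algebraMap_sub_adjMatrix] at h0
  have h1 := congrFun (h0.1 (by linarith [rayleigh_le G x])) u
  rw [sub_mulVec, Algebra.algebraMap_eq_smul_one, smul_mulVec, one_mulVec] at h1
  simp only [Pi.sub_apply, Pi.smul_apply, smul_eq_mul, SimpleGraph.adjMatrix_mulVec_apply,
    Pi.zero_apply] at h1
  linarith

/-- A nonnegative eigenvector for the spectral radius, with largest entry `1`. -/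
structure IsPerronVector (x : V → ℝ) : Prop where
  nonneg : ∀ u, 0 ≤ x u
  le_one : ∀ u, x u ≤ 1
  exists_eq_one : ∃ m, x m = 1
  eigen : ∀ u, ∑ w ∈ G.neighborFinset u, x w = adjSpectralRadius G * x u

theorem exists_isPerronVector : ∃ x, IsPerronVector G x := by
  have hspec := (isGreatest_spectrum_adjMatrix G).1
  rw [← spectrum_toLin', ← Module.End.hasEigenvalue_iff_mem_spectrum] at hspec
  obtain ⟨y, hy⟩ := hspec.exists_hasEigenvector
  have hy0 := hy.2
  have hyeig : ∀ u, ∑ w ∈ G.neighborFinset u, y w = adjSpectralRadius G * y u := by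
    intro u
    have := congrFun hy.apply_eq_smul u
    simpa [toLin'_apply, SimpleGraph.adjMatrix_mulVec_apply] using this
  -- Passing to absolute values does not decrease the Rayleigh quotient.
  have habs : ∀ u, ∑ w ∈ G.neighborFinset u, |y w| = adjSpectralRadius G * |y u| := by
    refine eigen_of_rayleigh_ge G (x := fun u => |y u|) ?_
    rw [mul_sum]
    refine sum_le_sum fun u _ => ?_
    calc adjSpectralRadius G * |y u| ^ 2 = y u * (adjSpectralRadius G * y u) := by
          rw [sq_abs]; ring
      _ = y u * ∑ w ∈ G.neighborFinset u, y w := by rw [hyeig]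
      _ ≤ |y u * ∑ w ∈ G.neighborFinset u, y w| := le_abs_self _
      _ ≤ |y u| * ∑ w ∈ G.neighborFinset u, |y w| := by
          rw [abs_mul]
          exact mul_le_mul_of_nonneg_left (abs_sum_le_sum_abs _ _) (abs_nonneg _)
  obtain ⟨m, -, hm⟩ := exists_max_image univ (fun u => |y u|) univ_nonempty
  obtain ⟨u₀, hu₀⟩ := Function.ne_iff.1 hy0
  have hmpos : 0 < |y m| := (abs_pos.2 hu₀).trans_le (hm u₀ (mem_univ _))
  refine ⟨fun u => |y u| / |y m|, fun u => by positivity, fun u => ?_, ⟨m, div_self hmpos.ne'⟩, ?_⟩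
  · exact (div_le_one hmpos).2 (hm u (mem_univ _))
  · intro u
    rw [← sum_div, habs, mul_div_assoc]

variable {G}

namespace IsPerronVector

variable {x : V → ℝ} (hx : IsPerronVector G x)
include hx

omit [DecidableEq V] [Nonempty V] in
theorem sum_sq_pos : 0 < ∑ u, x u ^ 2 := by
  obtain ⟨m, hm⟩ := hx.exists_eq_one
  refine sum_pos' (fun u _ => sq_nonneg _) ⟨m, mem_univ _, by rw [hm]; norm_num⟩

omit [Nonempty V] in
/-- If the spectral radius is at least `n - 2`, the entries of a Perron vector have total distance
at most `1` from `1`: the row of the entry `1` already forces their sum to be at least `n - 1`. -/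
theorem sum_one_sub_le (h : (Fintype.card V : ℝ) - 2 ≤ adjSpectralRadius G) :
    ∑ u, (1 - x u) ≤ 1 := by
  obtain ⟨m, hm⟩ := hx.exists_eq_one
  have h1 := hx.eigen m
  rw [hm, mul_one] at h1
  have h2 : ∑ w ∈ G.neighborFinset m, x w ≤ ∑ w ∈ univ.erase m, x w := by
    refine sum_le_sum_of_subset_of_nonneg (fun w hw => ?_) fun w _ _ => hx.nonneg w
    rw [SimpleGraph.mem_neighborFinset] at hw
    exact mem_erase.2 ⟨hw.ne', mem_univ _⟩
  have h3 := add_sum_erase univ x (mem_univ m)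
  rw [sum_sub_distrib, sum_const, card_univ, nsmul_eq_mul, mul_one]
  linarith

omit [Nonempty V] in
theorem one_le_add (h : (Fintype.card V : ℝ) - 2 ≤ adjSpectralRadius G) {u w : V} (huw : u ≠ w) :
    1 ≤ x u + x w := by
  have h1 : ∑ v ∈ {u, w}, (1 - x v) ≤ ∑ v, (1 - x v) :=
    sum_le_sum_of_subset_of_nonneg (subset_univ _) fun v _ _ => sub_nonneg.2 (hx.le_one v)
  rw [sum_pair huw] at h1
  linarith [hx.sum_one_sub_le h]

end IsPerronVector

/-- A graph of spectral radius at least `n - 2` has a complement with fewer than `n` edges. -/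
theorem sum_degree_compl_lt (h : (Fintype.card V : ℝ) - 2 ≤ adjSpectralRadius G) :
    ∑ u, Gᶜ.degree u < 2 * Fintype.card V := by
  obtain ⟨x, hx⟩ := exists_isPerronVector G
  set n : ℝ := (Fintype.card V : ℝ) with hn
  have hdeg : ∀ u, (G.degree u : ℝ) + Gᶜ.degree u = n - 1 := by
    intro u
    have h1 := G.degree_compl (v := u)
    have h2 := G.degree_lt_card_verts u
    have h3 : G.degree u + Gᶜ.degree u + 1 = Fintype.card V := by omega
    rw [hn, ← h3]
    push_cast
    ring
  have hsum : ∑ u, (G.degree u : ℝ) * x u = adjSpectralRadius G * ∑ u, x u := by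
    rw [mul_sum, ← sum_congr rfl fun u _ => hx.eigen u]
    rw [sum_comm' (t' := univ) (s' := fun u => G.neighborFinset u)]
    · simp
    · simp [G.adj_comm]
  have hle : ∀ u, (Gᶜ.degree u : ℝ) ≤ (n - 1) * x u - G.degree u * x u + (n - 1) * (1 - x u) := by
    intro u
    have h1 := hdeg u
    have h2 := hx.le_one u
    have h3 : (0 : ℝ) ≤ G.degree u := Nat.cast_nonneg _
    nlinarith
  have htot := sum_le_sum fun u (_ : u ∈ univ) => hle u
  rw [sum_add_distrib, sum_sub_distrib, ← mul_sum, ← mul_sum, hsum] at htot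
  have hσ0 : 0 ≤ ∑ u, x u := sum_nonneg fun u _ => hx.nonneg u
  have hσn : ∑ u, x u ≤ n := by
    calc ∑ u, x u ≤ ∑ _u : V, (1 : ℝ) := sum_le_sum fun u _ => hx.le_one u
      _ = n := by simp [hn]
  have hn1 : 1 ≤ n := by
    rw [hn]; exact_mod_cast Fintype.card_pos
  have h1 := mul_le_mul_of_nonneg_left (hx.sum_one_sub_le h) (sub_nonneg.2 hn1)
  have h2 := mul_le_mul_of_nonneg_right h hσ0
  have h3 : ∑ u, (Gᶜ.degree u : ℝ) < 2 * n := by nlinarith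
  rw [hn] at h3
  exact_mod_cast h3

variable {H : SimpleGraph V} [DecidableRel H.Adj]

theorem adjSpectralRadius_mono (hGH : G ≤ H) : adjSpectralRadius G ≤ adjSpectralRadius H := by
  obtain ⟨x, hx⟩ := exists_isPerronVector G
  refine le_of_mul_le_mul_right ?_ hx.sum_sq_pos
  refine le_trans ?_ (rayleigh_le H x)
  rw [mul_sum]
  refine sum_le_sum fun u _ => ?_
  rw [sq, mul_left_comm, ← hx.eigen]
  refine mul_le_mul_of_nonneg_left ?_ (hx.nonneg u)
  exact sum_le_sum_of_subset_of_nonneg (neighborFinset_subset_of_le hGH _)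
    fun w _ _ => hx.nonneg w

/-- Adding an edge strictly increases a spectral radius that is at least `n - 2`. Otherwise a
Perron vector of `G` is also one of `H`, so it vanishes at both ends of an added edge, whereas its
entries have total distance at most `1` from `1`. -/
theorem eq_of_le_of_adjSpectralRadius_eq (hGH : G ≤ H)
    (h : (Fintype.card V : ℝ) - 2 ≤ adjSpectralRadius G)
    (heq : adjSpectralRadius G = adjSpectralRadius H) : G = H := by
  obtain ⟨x, hx⟩ := exists_isPerronVector G
  have hsub : ∀ u, G.neighborFinset u ⊆ H.neighborFinset u := fun u =>
    neighborFinset_subset_of_le hGH _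
  have heig : ∀ u, ∑ w ∈ H.neighborFinset u, x w = adjSpectralRadius G * x u := by
    rw [heq]
    refine eigen_of_rayleigh_ge H ?_
    rw [← heq, mul_sum]
    refine sum_le_sum fun u _ => ?_
    rw [sq, mul_left_comm, ← hx.eigen]
    exact mul_le_mul_of_nonneg_left
      (sum_le_sum_of_subset_of_nonneg (hsub u) fun w _ _ => hx.nonneg w) (hx.nonneg u)
  have hzero : ∀ u w, H.Adj u w → ¬ G.Adj u w → x w ≤ 0 := by
    intro u w hH hG
    have h1 : ∑ v ∈ insert w (G.neighborFinset u), x v ≤ ∑ v ∈ H.neighborFinset u, x v := by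
      refine sum_le_sum_of_subset_of_nonneg (insert_subset ?_ (hsub u)) fun w _ _ => hx.nonneg w
      simpa using hH
    rw [sum_insert (by simpa using hG), heig, hx.eigen] at h1
    linarith
  refine le_antisymm hGH fun u w hH => ?_
  by_contra hG
  have h1 := hzero u w hH hG
  have h2 := hzero w u hH.symm fun h => hG h.symm
  linarith [hx.one_le_add h hH.ne]

end Spectral

/-! ### Cliques with one additional vertex -/

section StarClique

variable {V : Type*}

/-- The graph in which `v` is adjacent to the vertices of `K` and all other vertices form a
clique. -/
def starClique (v : V) (K : Finset V) : SimpleGraph V where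
  Adj u w := u ≠ w ∧ (u = v → w ∈ K) ∧ (w = v → u ∈ K)
  symm := ⟨fun _ _ h => ⟨h.1.symm, h.2.2, h.2.1⟩⟩
  loopless := ⟨fun _ h => h.1 rfl⟩

theorem starClique_adj {v : V} {K : Finset V} {u w : V} :
    (starClique v K).Adj u w ↔ u ≠ w ∧ (u = v → w ∈ K) ∧ (w = v → u ∈ K) := Iff.rfl

instance [DecidableEq V] (v : V) (K : Finset V) : DecidableRel (starClique v K).Adj := fun u w =>
  inferInstanceAs (Decidable (u ≠ w ∧ (u = v → w ∈ K) ∧ (w = v → u ∈ K)))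

variable [Fintype V] [DecidableEq V]

theorem nonempty_starClique_iso {n k : ℕ} (hn : Fintype.card V = n) {v : V} {K : Finset V}
    (hv : v ∉ K) (hk : K.card + 1 = k) : Nonempty (starClique v K ≃g extremalH n k) := by
  have hR : (univ \ insert v K).card = n - k := by
    rw [card_sdiff_of_subset (subset_univ _), card_univ, hn, card_insert_of_notMem hv, hk]
  let eK : Fin (k - 1) ≃ K := (K.equivFinOfCardEq (by omega)).symm
  let eR : Fin (n - k) ≃ (univ \ insert v K : Finset V) := (Finset.equivFinOfCardEq hR).symm
  have hKv : ∀ i, (eK i : V) ≠ v := fun i h => hv (h ▸ (eK i).2)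
  have hRv : ∀ i, (eR i : V) ≠ v ∧ (eR i : V) ∉ K := fun i => by
    simpa [not_or] using (mem_sdiff.1 (eR i).2).2
  let f : Fin (k - 1) ⊕ (Fin (n - k) ⊕ Fin 1) → V :=
    Sum.elim (fun i => eK i) (Sum.elim (fun i => eR i) fun _ => v)
  have hinj : Function.Injective f := by
    rintro (i | i | i) (j | j | j) h
    · exact congrArg _ (eK.injective (Subtype.ext h))
    · exact absurd (eK i).2 (by rw [show (eK i : V) = eR j from h]; exact (hRv j).2)
    · exact absurd h (hKv i)
    · exact absurd (eK j).2 (by rw [← show (eR i : V) = eK j from h]; exact (hRv i).2)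
    · exact congrArg _ (congrArg _ (eR.injective (Subtype.ext h)))
    · exact absurd h (hRv i).1
    · exact absurd h.symm (hKv j)
    · exact absurd h.symm (hRv j).1
    · rw [Subsingleton.elim i j]
  have hsurj : Function.Surjective f := by
    intro u
    by_cases hu : u = v
    · exact ⟨Sum.inr (Sum.inr 0), hu.symm⟩
    by_cases huK : u ∈ K
    · exact ⟨Sum.inl (eK.symm ⟨u, huK⟩), by simp [f]⟩
    · exact ⟨Sum.inr (Sum.inl (eR.symm ⟨u, by simp [hu, huK]⟩)), by simp [f]⟩
  refine ⟨RelIso.symm ⟨Equiv.ofBijective f ⟨hinj, hsurj⟩, fun {a b} => ?_⟩⟩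
  change (starClique v K).Adj (f a) (f b) ↔ (extremalH n k).Adj a b
  rw [starClique_adj, hinj.ne_iff]
  rcases a with i | i | i <;> rcases b with j | j | j <;>
    simp [f, extremalH, graphJoin, hKv, hRv, hv]
  exact Subsingleton.elim i j

theorem card_sub_two_le_starClique (v : V) (K : Finset V) (hV : 2 ≤ Fintype.card V) :
    (Fintype.card V : ℝ) - 2 ≤ adjSpectralRadius (starClique v K) := by
  have : Nonempty V := ⟨v⟩
  have h := rayleigh_le (starClique v K) fun u => if u = v then 0 else 1
  have hrow : ∀ u, u ≠ v → ∑ w ∈ (starClique v K).neighborFinset u, (if w = v then (0 : ℝ) else 1)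
      = Fintype.card V - 2 := by
    intro u hu
    have h1 : {w ∈ (starClique v K).neighborFinset u | ¬ w = v} = univ \ {u, v} := by
      ext w
      simp only [mem_filter, SimpleGraph.mem_neighborFinset, starClique_adj, mem_sdiff, mem_univ,
        true_and, mem_insert, mem_singleton, not_or]
      tauto
    have h2 : (univ \ {u, v} : Finset V).card + 2 = Fintype.card V := by
      rw [card_sdiff_of_subset (subset_univ _), card_univ, card_pair hu]
      omega
    rw [← h2, sum_ite, sum_const_zero, zero_add, sum_const, h1]
    simp
  have hL : ∑ u, (if u = v then (0 : ℝ) else 1) *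
      ∑ w ∈ (starClique v K).neighborFinset u, (if w = v then (0 : ℝ) else 1)
      = ((Fintype.card V : ℝ) - 2) * ∑ u, (if u = v then (0 : ℝ) else 1) ^ 2 := by
    rw [mul_sum]
    refine sum_congr rfl fun u _ => ?_
    by_cases hu : u = v
    · simp [hu]
    · rw [hrow u hu]; simp [hu]
  rw [hL] at h
  obtain ⟨u, hu⟩ := Fintype.exists_ne_of_one_lt_card (by omega : 1 < Fintype.card V) v
  refine le_of_mul_le_mul_right h (sum_pos' (fun u _ => sq_nonneg _) ⟨u, mem_univ _, ?_⟩)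
  simp [hu]

/-- Let `v` have fewer than `n / 10` neighbours, and let `G` have at least the spectral radius of
the clique with `v` joined to a set `K` of neighbours of `v`. Replacing `G` by the latter removes
`G.degree v - K.card` edges at `v`, each of little weight for the Perron vector since the entry at
`v` is small, and adds the missing edges away from `v`, each of weight close to `1`. Hence fewer
than `G.degree v - K.card` neighbours of `v` are incident with missing edges. -/
theorem card_filter_degree_compl_ne_zero_lt {G : SimpleGraph V} [DecidableRel G.Adj] {v : V}
    {K : Finset V} (hK : K ⊂ G.neighborFinset v) (hV : 1000 ≤ Fintype.card V)
    (hv : 10 * G.degree v ≤ Fintype.card V)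
    (hG : adjSpectralRadius (starClique v K) ≤ adjSpectralRadius G) :
    {u ∈ G.neighborFinset v | Gᶜ.degree u ≠ 0}.card + K.card < G.degree v := by
  have : Nonempty V := ⟨v⟩
  set W := {u ∈ G.neighborFinset v | Gᶜ.degree u ≠ 0} with hW
  set H := starClique v K with hH
  have hlam := (card_sub_two_le_starClique v K (by omega)).trans hG
  obtain ⟨x, hx⟩ := exists_isPerronVector G
  have hvK : v ∉ K := fun h => by simpa using hK.1 h
  have hVr : (1000 : ℝ) ≤ Fintype.card V := by exact_mod_cast hV
  have hvr : 10 * (G.degree v : ℝ) ≤ Fintype.card V := by exact_mod_cast hv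
  have hxv : x v ≤ 11 / 100 := by
    have h1 := hx.eigen v
    have h2 : ∑ w ∈ G.neighborFinset v, x w ≤ G.degree v := by
      refine (sum_le_card_nsmul _ _ 1 fun w _ => hx.le_one w).trans (by simp)
    have h3 := mul_le_mul_of_nonneg_right hlam (hx.nonneg v)
    by_contra! hcon
    nlinarith
  have hxu : ∀ u, u ≠ v → 85 / 100 ≤ x u := fun u hu => by
    linarith [hx.one_le_add hlam hu]
  have hdiff : (0 : ℝ) ≤ ∑ u, x u *
      (∑ w ∈ G.neighborFinset u, x w - ∑ w ∈ H.neighborFinset u, x w) := by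
    simp only [mul_sub, sum_sub_distrib]
    have h1 := rayleigh_le H x
    have h2 : ∑ u, x u * ∑ w ∈ G.neighborFinset u, x w = adjSpectralRadius G * ∑ u, x u ^ 2 := by
      rw [mul_sum]
      refine sum_congr rfl fun u _ => ?_
      rw [hx.eigen]; ring
    have h3 := mul_le_mul_of_nonneg_right hG hx.sum_sq_pos.le
    linarith
  have hrowv : ∑ w ∈ G.neighborFinset v, x w - ∑ w ∈ H.neighborFinset v, x w ≤
      (G.neighborFinset v \ K).card := by
    have h1 : H.neighborFinset v = K := by
      ext w
      simp only [SimpleGraph.mem_neighborFinset, hH, starClique_adj, true_imp_iff]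
      refine ⟨fun h => h.2.1, fun h => ⟨?_, h, ?_⟩⟩
      · rintro rfl; exact hvK h
      · rintro rfl; exact absurd h hvK
    rw [h1, ← sum_sdiff hK.1, add_sub_cancel_right]
    exact (sum_le_card_nsmul _ _ 1 fun w _ => hx.le_one w).trans (by simp)
  have hrow : ∀ u, u ≠ v → ∑ w ∈ G.neighborFinset u, x w - ∑ w ∈ H.neighborFinset u, x w ≤
      (if u ∈ G.neighborFinset v \ K then x v else 0) - if u ∈ W then 85 / 100 else 0 := by
    intro u hu
    have eG : ∑ w ∈ G.neighborFinset u, x w = ∑ w ∈ (G.neighborFinset u).erase v, x w +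
        if G.Adj v u then x v else 0 := by
      split_ifs with h
      · rw [sum_erase_add]; simpa using h.symm
      · rw [erase_eq_of_notMem (by simpa [G.adj_comm] using h), add_zero]
    have eH : ∑ w ∈ H.neighborFinset u, x w = ∑ w ∈ (H.neighborFinset u).erase v, x w +
        if u ∈ K then x v else 0 := by
      split_ifs with h
      · rw [sum_erase_add]; simp [hH, starClique_adj, hu, h]
      · rw [erase_eq_of_notMem (by simp [hH, starClique_adj, hu, h]), add_zero]
    have hsub : (G.neighborFinset u).erase v ⊆ (H.neighborFinset u).erase v := by
      intro w hw
      simp only [mem_erase, SimpleGraph.mem_neighborFinset, hH, starClique_adj] at hw ⊢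
      exact ⟨hw.1, hw.2.ne, fun h => absurd h hu, fun h => absurd h hw.1⟩
    have hmain : ∑ w ∈ (G.neighborFinset u).erase v, x w + (if u ∈ W then 85 / 100 else 0) ≤
        ∑ w ∈ (H.neighborFinset u).erase v, x w := by
      split_ifs with h
      · rw [hW, mem_filter, SimpleGraph.mem_neighborFinset] at h
        obtain ⟨w, hw⟩ := (Gᶜ.degree_pos_iff_exists_adj u).1 (Nat.pos_of_ne_zero h.2)
        rw [SimpleGraph.compl_adj] at hw
        have hwv : w ≠ v := by rintro rfl; exact hw.2 h.1.symm
        have h1 : insert w ((G.neighborFinset u).erase v) ⊆ (H.neighborFinset u).erase v := by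
          refine insert_subset ?_ hsub
          simp [hH, starClique_adj, hu, hwv, hw.1]
        have h2 := sum_le_sum_of_subset_of_nonneg h1 fun w _ _ => hx.nonneg w
        rw [sum_insert (by simp [hw.2])] at h2
        linarith [hxu w hwv]
      · rw [add_zero]
        exact sum_le_sum_of_subset_of_nonneg hsub fun w _ _ => hx.nonneg w
    have hsplit : (if G.Adj v u then x v else 0) =
        (if u ∈ G.neighborFinset v \ K then x v else 0) + if u ∈ K then x v else 0 := by
      by_cases h : u ∈ K
      · have : G.Adj v u := by simpa using hK.1 h
        simp [h, this]
      · simp [h]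
    linarith
  have hWv : v ∉ W := by simp [hW]
  have hterm : ∀ u, x u * (∑ w ∈ G.neighborFinset u, x w - ∑ w ∈ H.neighborFinset u, x w) ≤
      (if u = v then 11 / 100 * ((G.neighborFinset v \ K).card : ℝ) else 0) +
      (if u ∈ G.neighborFinset v \ K then 11 / 100 else 0) - if u ∈ W then 72 / 100 else 0 := by
    intro u
    have h0 := hx.nonneg u
    have h1 := hx.le_one u
    by_cases hu : u = v
    · subst hu
      have hc : (0 : ℝ) ≤ (G.neighborFinset u \ K).card := Nat.cast_nonneg _
      simp only [if_true, hWv, if_false, sub_zero, mem_sdiff, SimpleGraph.mem_neighborFinset,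
        SimpleGraph.irrefl, false_and, add_zero]
      exact (mul_le_mul_of_nonneg_left hrowv h0).trans (mul_le_mul_of_nonneg_right hxv hc)
    · have h2 := hxu u hu
      have h3 := mul_le_mul_of_nonneg_left (hrow u hu) h0
      have h4 := hx.nonneg v
      rw [if_neg hu]
      refine h3.trans ?_
      split_ifs <;> nlinarith
  have htot := hdiff.trans (sum_le_sum fun u (_ : u ∈ univ) => hterm u)
  simp only [sum_sub_distrib, sum_add_distrib, sum_ite_mem, univ_inter, sum_const, nsmul_eq_mul,
    sum_ite_eq', mem_univ, if_true] at htot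
  have hcard : (G.neighborFinset v \ K).card + K.card = G.degree v := by
    rw [card_sdiff_add_card_eq_card hK.1, SimpleGraph.card_neighborFinset_eq_degree]
  have hpos : 0 < (G.neighborFinset v \ K).card := by
    have := card_lt_card hK
    rw [SimpleGraph.card_neighborFinset_eq_degree] at this
    omega
  have hposr : (0 : ℝ) < (G.neighborFinset v \ K).card := by exact_mod_cast hpos
  have hlt : (W.card : ℝ) < (G.neighborFinset v \ K).card := by linarith
  have hlt' : W.card < (G.neighborFinset v \ K).card := by exact_mod_cast hlt
  omega

end StarClique

/-! ### Containment of sparse spanning graphs -/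

section Main

variable {α β : Type*} [Fintype α] [Fintype β] [DecidableEq α] [DecidableEq β]

theorem degree_add_degree_le (B : SimpleGraph β) [DecidableRel B.Adj] {s t : β} (h : s ≠ t) :
    2 * (B.degree s + B.degree t) ≤ ∑ v, B.degree v + 2 := by
  rw [B.sum_degrees_eq_twice_card_edges, ← B.card_incidenceFinset_eq_degree,
    ← B.card_incidenceFinset_eq_degree, ← card_union_add_card_inter]
  have h1 : (B.incidenceFinset s ∪ B.incidenceFinset t).card ≤ B.edgeFinset.card :=
    card_le_card (union_subset (B.incidenceFinset_subset s) (B.incidenceFinset_subset t))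
  have h2 : (B.incidenceFinset s ∩ B.incidenceFinset t).card ≤ 1 := by
    rw [← card_singleton s(s, t)]
    refine card_le_card fun e he => ?_
    rw [mem_inter, SimpleGraph.mem_incidenceFinset, SimpleGraph.mem_incidenceFinset] at he
    simpa using B.incidenceSet_inter_incidenceSet_subset h he
  omega

/-- For sparse `F`, a graph `G` of minimum degree at least that of `F` contains `F` as soon as its
spectral radius is at least that of the cliques with one additional vertex, of degree one less than
the minimum degree of `F`. -/
theorem isContained_of_starClique_le {F : SimpleGraph α} [DecidableRel F.Adj]
    {G : SimpleGraph β} [DecidableRel G.Adj] (hcard : Fintype.card α = Fintype.card β)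
    (hδ : 0 < F.minDegree) (hn₀ : 1000 ≤ Fintype.card α)
    (hn₁ : 1600 * (F.maxDegree * F.maxDegree) ≤ Fintype.card α)
    (hn₂ : 40000 * F.maxDegree ≤ Fintype.card α) (hdeg : ∀ v, F.minDegree ≤ G.degree v)
    (hG : ∀ (v : β) (K : Finset β), v ∉ K → K.card + 1 = F.minDegree →
      adjSpectralRadius (starClique v K) ≤ adjSpectralRadius G) :
    F.IsContained G := by
  have : Nonempty α := Fintype.card_pos_iff.1 (by omega)
  have : Nonempty β := Fintype.card_pos_iff.1 (by omega)
  obtain ⟨x₁, hx₁⟩ := F.exists_minimal_degree_vertex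
  have hΔ : 0 < F.maxDegree := hδ.trans_le (hx₁ ▸ F.degree_le_maxDegree x₁)
  -- `v₁` is the vertex that may have small degree in `G`.
  obtain ⟨v₁, -, hmax⟩ := exists_max_image univ (fun v => Gᶜ.degree v) univ_nonempty
  have hK : ∃ K ⊂ G.neighborFinset v₁, K.card + 1 = F.minDegree := by
    obtain ⟨K, hK, hKc⟩ := exists_subset_card_eq (s := G.neighborFinset v₁)
      (n := F.minDegree - 1) (by rw [G.card_neighborFinset_eq_degree]; have := hdeg v₁; omega)
    refine ⟨K, hK.ssubset_of_ne fun h => ?_, by omega⟩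
    rw [h, G.card_neighborFinset_eq_degree] at hKc
    have := hdeg v₁
    omega
  obtain ⟨K, hKs, hKc⟩ := hK
  have hvK : v₁ ∉ K := fun h => by simpa using hKs.1 h
  have hB : ∑ v, Gᶜ.degree v < 2 * Fintype.card α := by
    rw [hcard]
    exact sum_degree_compl_lt
      ((card_sub_two_le_starClique v₁ K (by omega)).trans (hG v₁ K hvK hKc))
  have hhalf : ∀ s, s ≠ v₁ → 2 * Gᶜ.degree s ≤ Fintype.card α := by
    intro s hs
    have h1 := degree_add_degree_le Gᶜ hs
    have h2 := hmax s (mem_univ _)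
    omega
  have hsafe : ∃ (T : Finset β) (f : β → α), IsSafe F Gᶜ T f ∧ v₁ ∈ T ∧
      T.card ≤ F.maxDegree + 1 := by
    by_cases hv : 10 * G.degree v₁ ≤ Fintype.card β
    · -- The neighbours of a vertex of `F` of minimum degree are mapped to vertices adjacent to all
      -- vertices of `G`.
      have hW := card_filter_degree_compl_ne_zero_lt hKs (by omega) hv (hG v₁ K hvK hKc)
      have hsplit := card_filter_add_card_filter_not (s := G.neighborFinset v₁)
        fun u => Gᶜ.degree u ≠ 0
      rw [G.card_neighborFinset_eq_degree] at hsplit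
      obtain ⟨U, hU, hUc⟩ := exists_subset_card_eq
        (s := {u ∈ G.neighborFinset v₁ | ¬ Gᶜ.degree u ≠ 0}) (n := F.degree x₁) (by omega)
      have hU0 : ∀ u ∈ U, Gᶜ.degree u = 0 := fun u hu => not_not.1 (mem_filter.1 (hU hu)).2
      have hUv : v₁ ∉ U := fun h => by simpa using (mem_filter.1 (hU h)).1
      have hUadj : ∀ u ∈ U, ∀ w, ¬ Gᶜ.Adj u w := fun u hu w hw =>
        ((Gᶜ.degree_pos_iff_exists_adj u).2 ⟨w, hw⟩).ne' (hU0 u hu)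
      let e : U ≃ F.neighborFinset x₁ :=
        Finset.equivOfCardEq (by rw [hUc, F.card_neighborFinset_eq_degree])
      let f : β → α := fun u => if h : u ∈ U then (e ⟨u, h⟩ : α) else x₁
      have hfv : f v₁ = x₁ := dif_neg hUv
      have hfU : ∀ u (h : u ∈ U), f u = e ⟨u, h⟩ := fun u h => dif_pos h
      have hfadj : ∀ u ∈ U, F.Adj x₁ (f u) := fun u h => by
        rw [hfU u h]
        exact (F.mem_neighborFinset _ _).1 (e ⟨u, h⟩).2
      refine ⟨insert v₁ U, f, ⟨?_, ?_, ?_⟩, mem_insert_self _ _, ?_⟩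
      · rw [coe_insert, Set.injOn_insert (by simpa using hUv)]
        refine ⟨fun a ha b hb hab => ?_, ?_⟩
        · rw [hfU a ha, hfU b hb] at hab
          exact congrArg Subtype.val (e.injective (Subtype.ext hab))
        · rintro ⟨u, hu, huv⟩
          exact (hfadj u hu).ne (hfv.symm.trans huv.symm)
      · intro s hs t ht _ hst
        rcases mem_insert.1 hs with rfl | hs
        · rcases mem_insert.1 ht with rfl | ht
          · exact hst.ne rfl
          · exact hUadj t ht _ hst.symm
        · exact hUadj s hs _ hst
      · intro y hy
        have hzero : ∑ s ∈ insert v₁ U with F.Adj (f s) y, Gᶜ.degree s = 0 := by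
          refine sum_eq_zero fun s hs => ?_
          obtain ⟨hs, hsy⟩ := mem_filter.1 hs
          rcases mem_insert.1 hs with rfl | hs
          · rw [hfv] at hsy
            refine (hy (mem_image.2 ⟨e.symm ⟨y, by simpa using hsy⟩, ?_, ?_⟩)).elim
            · exact mem_insert_of_mem (e.symm _).2
            · rw [hfU _ (e.symm _).2]
              simp
          · exact hU0 s hs
        rw [hzero]
        omega
      · rw [card_insert_of_notMem hUv, hUc]
        exact Nat.add_le_add_right (F.degree_le_maxDegree _) 1
    · refine ⟨{v₁}, fun _ => x₁, ⟨by simp, by simp, fun y _ => ?_⟩, by simp, by simp⟩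
      have h1 : ∑ s ∈ {v₁} with F.Adj x₁ y, Gᶜ.degree s ≤ Gᶜ.degree v₁ :=
        (sum_le_sum_of_subset (filter_subset _ _)).trans (by simp)
      have h2 := G.degree_compl (v := v₁)
      omega
  obtain ⟨T, f, hf, hvT, hT⟩ := hsafe
  obtain ⟨π, hπ⟩ := hf.exists_packing F.degree_le_maxDegree hΔ hcard hn₁ hn₂ hT hB.le
    fun s hs => hhalf s (by rintro rfl; exact hs hvT)
  refine ⟨⟨⟨π, fun {a b} hab => ?_⟩, π.injective⟩⟩
  have h1 := hπ a b hab
  rw [SimpleGraph.compl_adj, not_and, not_not] at h1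
  exact h1 (π.injective.ne hab.ne)

theorem exists_le_starClique {G : SimpleGraph β} [DecidableRel G.Adj] {v : β} {k : ℕ}
    (hv : G.degree v < k) (hk : k ≤ Fintype.card β) :
    ∃ K : Finset β, v ∉ K ∧ K.card + 1 = k ∧ G ≤ starClique v K := by
  obtain ⟨K, hNK, hKv, hKc⟩ := exists_subsuperset_card_eq (s := G.neighborFinset v)
    (t := univ.erase v) (n := k - 1) (fun w hw => by
      rw [SimpleGraph.mem_neighborFinset] at hw
      exact mem_erase.2 ⟨hw.ne', mem_univ _⟩)
    (by rw [G.card_neighborFinset_eq_degree]; omega)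
    (by rw [card_erase_of_mem (mem_univ _), card_univ]; omega)
  refine ⟨K, fun h => by simpa using hKv h, by omega, fun u w huw => ⟨huw.ne, ?_, ?_⟩⟩
  · rintro rfl
    exact hNK (by simpa using huw)
  · rintro rfl
    exact hNK (by simpa using huw.symm)

end Main

end SpectralSpanning

theorem mainTheorem1 :
    ∃ N : ℕ, ∀ n : ℕ, N ≤ n →
      ∀ (F : SimpleGraph (Fin n)) [DecidableRel F.Adj],
        (∀ v : Fin n, ¬ F.IsIsolated v) →
        (F.maxDegree : ℝ) ≤ Real.sqrt (n : ℝ) / 40 →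
        ∀ G : SimpleGraph (Fin n), F.Free G →
          adjSpectralRadius G ≤ adjSpectralRadius (extremalH n F.minDegree) ∧
          (adjSpectralRadius G = adjSpectralRadius (extremalH n F.minDegree) ↔
            Nonempty (G ≃g extremalH n F.minDegree)) := by
  classical
  open SpectralSpanning in
  refine ⟨1000000, fun n hn F _ hiso hΔ G hfree => ?_⟩
  have : Nonempty (Fin n) := ⟨⟨0, by omega⟩⟩
  have hδ : 0 < F.minDegree := by
    obtain ⟨x, hx⟩ := F.exists_minimal_degree_vertex
    rw [hx, F.degree_pos_iff_exists_adj]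
    simpa [SimpleGraph.IsIsolated] using hiso x
  have hδn : F.minDegree < n := by
    obtain ⟨x, hx⟩ := F.exists_minimal_degree_vertex
    simpa [hx] using F.degree_lt_card_verts x
  have hn₁ : 1600 * (F.maxDegree * F.maxDegree) ≤ n := by
    have h1 : 40 * (F.maxDegree : ℝ) ≤ Real.sqrt n := by linarith
    have h3 : (40 * (F.maxDegree : ℝ)) ^ 2 ≤ (n : ℝ) := by
      calc (40 * (F.maxDegree : ℝ)) ^ 2 ≤ Real.sqrt n ^ 2 := by gcongr
        _ = (n : ℝ) := Real.sq_sqrt (Nat.cast_nonneg n)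
    have h4 : (((40 * F.maxDegree) ^ 2 : ℕ) : ℝ) ≤ n := by exact_mod_cast h3
    have h5 : (40 * F.maxDegree) ^ 2 ≤ n := by exact_mod_cast h4
    linarith
  -- This is where `n ≥ 10 ^ 6` is used: `40 Δ ≤ √n ≤ n / 1000`.
  have hn₂ : 40000 * F.maxDegree ≤ n := by
    by_cases h : 25 ≤ F.maxDegree
    · nlinarith
    · omega
  have hH : ∀ (v : Fin n) (K : Finset (Fin n)), v ∉ K → K.card + 1 = F.minDegree →
      adjSpectralRadius (starClique v K) = adjSpectralRadius (extremalH n F.minDegree) :=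
    fun v K hv hK => (nonempty_starClique_iso (Fintype.card_fin n) hv hK).elim
      adjSpectralRadius_eq_of_iso
  by_cases hlow : ∃ v, G.degree v < F.minDegree
  · obtain ⟨v, hv⟩ := hlow
    obtain ⟨K, hvK, hKc, hle⟩ := exists_le_starClique hv (by simpa using hδn.le)
    rw [← hH v K hvK hKc]
    refine ⟨adjSpectralRadius_mono hle, fun heq => ?_, fun ⟨e⟩ => ?_⟩
    · have hlarge := card_sub_two_le_starClique v K (by simp; omega)
      rw [eq_of_le_of_adjSpectralRadius_eq hle (by rwa [heq]) heq]
      exact nonempty_starClique_iso (Fintype.card_fin n) hvK hKc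
    · rw [hH v K hvK hKc]
      exact adjSpectralRadius_eq_of_iso e
  · push Not at hlow
    have hlt : adjSpectralRadius G < adjSpectralRadius (extremalH n F.minDegree) := by
      by_contra! hge
      refine hfree (isContained_of_starClique_le rfl hδ (by simp; omega) (by simpa using hn₁)
        (by simpa using hn₂) hlow fun v K hvK hKc => ?_)
      rwa [hH v K hvK hKc]
    exact ⟨hlt.le, fun h => absurd h hlt.ne, fun ⟨e⟩ => adjSpectralRadius_eq_of_iso e⟩
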